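/- Let $q\in\mathbb C$ with $|q|=1$. An operator $V$ on a complex Hilbert space is a \emph{shift} if it is an isometry and $V^{*n}\to 0$ strongly. A pair $(V_1,V_2)$ is \emph{doubly $q$-commutative} if $V_1V_2=qV_2V_1$ and $V_2V_1^*=qV_1^*V_2$. For a complex Hilbert space $\mathcal E$, let $H^2(\mathbb D^2;\mathcal E)$ be the Hardy space of functions $f(z_1,z_2)=\sum_{i,j\ge 0}z_1^iz_2^ja_{ij}$ on the bidisc with $a_{ij}\in\mathcal E$ and $\|f\|^2=\sum\|a_{ij}\|^2<\infty$, write $H^2(\mathbb D^2)=H^2(\mathbb D^2;\mathbb C)$, let $M_{z_1},M_{z_2}$ be the multiplications by the coordinates, and put $M=M_{z_1}M_{z_2}$. For unimodular $p$ let $\mathfrak s_p$ be the unitary on $H^2(\mathbb D^2;\mathcal E)$ given by $$\mathfrak s_p f=\sum_{n\ge 0}p^nM^n(I-MM^*)M^{*n}f ,$$ so that $\mathfrak s_{\bar p}=\mathfrak s_p^*$. Let $(V_1,V_2)$ be a pair of shift operators on a complex Hilbert space $\mathcal H$. Then: 1. $(V_1,V_2)$ is doubly $q$-commutative if and only if,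 for some complex Hilbert space $\mathcal E$, it is jointly unitarily equivalent to $(M_{z_1}\mathfrak s_q,\ \mathfrak s_{\bar q}M_{z_2})$ on $H^2(\mathbb D^2;\mathcal E)$. 2. $(V_1,V_2)$ is doubly $q$-commutative with $\dim(\ker V_1^*\cap\ker V_2^*)=1$ if and only if it is jointly unitarily equivalent to $(M_{z_1}\mathfrak s_q,\ \mathfrak s_{\bar q}M_{z_2})$ on the scalar Hardy space $H^2(\mathbb D^2)$. -/

import Mathlib

open Complex Filter Topology InnerProductSpace
open scoped ComplexConjugate

universe u v

noncomputable section

namespace QShift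

/-! ### The Hardy space of the bidisc -/

/-- The Hilbert space `ℓ²(ℕ × ℕ; E)` of square summable double sequences in `E`. -/
abbrev Coeff (E : Type u) [NormedAddCommGroup E] : Type u :=
  lp (fun _ : ℕ × ℕ => E) 2

section Hardy

variable (E : Type u) [NormedAddCommGroup E] [InnerProductSpace ℂ E] [CompleteSpace E]

variable {E}

theorem summable_powerSeries (a : Coeff E) (p : UnitDisc × UnitDisc) :
    Summable fun n : ℕ × ℕ => ((p.1 : ℂ) ^ n.1 * (p.2 : ℂ) ^ n.2) • a n := by
  have h : Summable fun n : ℕ × ℕ => ‖(p.1 : ℂ)‖ ^ n.1 * ‖(p.2 : ℂ)‖ ^ n.2 :=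
    (summable_geometric_of_lt_one (norm_nonneg _) p.1.norm_lt_one).mul_of_nonneg
      (summable_geometric_of_lt_one (norm_nonneg _) p.2.norm_lt_one)
      (fun _ => by positivity) (fun _ => by positivity)
  refine Summable.of_norm_bounded (h.mul_right ‖a‖) fun n => ?_
  rw [norm_smul, norm_mul, norm_pow, norm_pow]
  gcongr
  exact lp.norm_apply_le_norm (by norm_num) a n

/-- The function `(z₁, z₂) ↦ ∑ z₁ⁱ z₂ʲ a_{ij}` on the bidisc. -/
def powerSeries : Coeff E →ₗ[ℂ] (UnitDisc × UnitDisc → E) where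
  toFun a p := ∑' n : ℕ × ℕ, ((p.1 : ℂ) ^ n.1 * (p.2 : ℂ) ^ n.2) • a n
  map_add' a b := by
    funext p
    simp only [lp.coeFn_add, Pi.add_apply, smul_add]
    exact (summable_powerSeries a p).tsum_add (summable_powerSeries b p)
  map_smul' c a := by
    funext p
    simp only [lp.coeFn_smul, Pi.smul_apply, RingHom.id_apply]
    rw [← (summable_powerSeries a p).tsum_const_smul c]
    exact tsum_congr fun n => smul_comm _ _ _

theorem coeff_eq_zero_of_hasSum {b : ℕ → E}
    (h : ∀ z : UnitDisc, HasSum (fun n => (z : ℂ) ^ n • b n) 0) : b = 0 := by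
  let P : FormalMultilinearSeries ℂ ℂ E :=
    fun n => ContinuousMultilinearMap.mkPiRing ℂ (Fin n) (b n)
  have hP : ∀ n, P.coeff n = b n := fun n => by
    simp [P, FormalMultilinearSeries.coeff]
  have h0 : HasFPowerSeriesAt (0 : ℂ → E) P 0 := by
    rw [hasFPowerSeriesAt_iff]
    filter_upwards [Metric.ball_mem_nhds (0 : ℂ) one_pos] with z hz
    have hz' : ‖z‖ < 1 := by simpa using hz
    simpa [hP] using h (UnitDisc.mk z hz')
  funext n
  rw [← hP n, h0.eq_zero]
  rfl

theorem powerSeries_injective : Function.Injective (powerSeries (E := E)) := by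
  rw [← LinearMap.ker_eq_bot, LinearMap.ker_eq_bot']
  intro a ha
  have hs : ∀ w : UnitDisc, ∀ i, Summable fun j => ((w : ℂ) ^ j) • a (i, j) := by
    intro w i
    have h : Summable fun j : ℕ => ‖(w : ℂ)‖ ^ j :=
      summable_geometric_of_lt_one (norm_nonneg _) w.norm_lt_one
    refine Summable.of_norm_bounded (h.mul_right ‖a‖) fun n => ?_
    rw [norm_smul, norm_pow]
    gcongr
    exact lp.norm_apply_le_norm (by norm_num) a _
  have h1 : ∀ w : UnitDisc, (fun i => ∑' j, ((w : ℂ) ^ j) • a (i, j)) = 0 := by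
    intro w
    refine coeff_eq_zero_of_hasSum fun z => ?_
    have hz : HasSum (fun n : ℕ × ℕ => ((z : ℂ) ^ n.1 * (w : ℂ) ^ n.2) • a n) 0 := by
      have := (summable_powerSeries a (z, w)).hasSum
      have h0 : powerSeries a (z, w) = 0 := by rw [ha]; rfl
      change HasSum _ (powerSeries a (z, w)) at this
      rwa [h0] at this
    refine hz.prod_fiberwise fun i => ?_
    have := (hs w i).hasSum.const_smul ((z : ℂ) ^ i)
    simpa only [mul_smul] using this
  have h2 : ∀ i, (fun j => a (i, j)) = 0 := fun i =>
    coeff_eq_zero_of_hasSum fun w => by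
      have := (hs w i).hasSum
      rwa [show ∑' j, ((w : ℂ) ^ j) • a (i, j) = 0 from congrFun (h1 w) i] at this
  ext n
  exact congrFun (h2 n.1) n.2

variable (E)

/-- The functions on the bidisc which are sums of power series with square summable
coefficients in `E`. -/
def hardySubmodule : Submodule ℂ (UnitDisc × UnitDisc → E) :=
  LinearMap.range (powerSeries (E := E))

/-- The Hardy space `H²(𝔻²; E)` of `E`-valued functions on the bidisc. -/
def Hardy : Type u := hardySubmodule E

namespace Hardy

instance : AddCommGroup (Hardy E) := inferInstanceAs (AddCommGroup (hardySubmodule E))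

instance : Module ℂ (Hardy E) := inferInstanceAs (Module ℂ (hardySubmodule E))

instance : CoeFun (Hardy E) (fun _ => UnitDisc × UnitDisc → E) := ⟨fun f => f.1⟩

/-- A function in the Hardy space corresponds to its double sequence of Taylor coefficients. -/
def coeffEquiv : Hardy E ≃ₗ[ℂ] Coeff E :=
  (LinearEquiv.ofInjective (powerSeries (E := E)) powerSeries_injective).symm

/-- `‖f‖² = ∑ ‖a_{ij}‖²`, where `a` are the Taylor coefficients of `f`. -/
instance : NormedAddCommGroup (Hardy E) :=
  NormedAddCommGroup.induced (Hardy E) (Coeff E) (coeffEquiv E) (coeffEquiv E).injective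

/-- `⟪f, g⟫ = ∑ ⟪a_{ij}, b_{ij}⟫`, where `a` and `b` are the Taylor coefficients. -/
instance : InnerProductSpace ℂ (Hardy E) where
  toNormedSpace := NormedSpace.induced ℂ (Hardy E) (Coeff E) (coeffEquiv E)
  inner f g := inner ℂ (coeffEquiv E f) (coeffEquiv E g)
  norm_sq_eq_re_inner f := norm_sq_eq_re_inner (𝕜 := ℂ) (coeffEquiv E f)
  conj_inner_symm f g := inner_conj_symm (coeffEquiv E f) (coeffEquiv E g)
  add_left f g h := by rw [map_add, inner_add_left]
  smul_left f g r := by rw [map_smul, inner_smul_left]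

/-- The unitary from the Hardy space onto the space of Taylor coefficients. -/
def coeffIso : Hardy E ≃ₗᵢ[ℂ] Coeff E where
  toLinearEquiv := coeffEquiv E
  norm_map' _ := rfl

instance : CompleteSpace (Hardy E) :=
  (completeSpace_congr (e := (coeffIso E).toLinearEquiv.toEquiv)
    (coeffIso E).isometry.isUniformEmbedding).2 inferInstance

variable {E}

theorem ext {f g : Hardy E} (h : ∀ p, f p = g p) : f = g := Subtype.ext (funext h)

theorem apply_eq_tsum (f : Hardy E) (p : UnitDisc × UnitDisc) :
    f p = ∑' n : ℕ × ℕ, ((p.1 : ℂ) ^ n.1 * (p.2 : ℂ) ^ n.2) • coeffIso E f n := by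
  have h := (coeffEquiv E).symm_apply_apply f
  conv_lhs => rw [← h]
  rfl

/-- Reindexing of coefficients along an injective map, with zeros outside its range. -/
def reindex (g : ℕ × ℕ → ℕ × ℕ) (hg : Function.Injective g) (a : Coeff E) : Coeff E :=
  ⟨Function.extend g a 0, by
    have h2 : 0 < (2 : ENNReal).toReal := by norm_num
    refine (memℓp_gen_iff h2).2 ?_
    have h := (memℓp_gen_iff h2).1 (lp.memℓp a)
    refine (hg.summable_iff fun n hn => ?_).1 ?_
    · rw [Function.extend_apply' _ _ _ (by simpa using hn)]
      simp
    · simpa [Function.comp_def, hg.extend_apply] using h⟩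

theorem norm_reindex (g : ℕ × ℕ → ℕ × ℕ) (hg : Function.Injective g) (a : Coeff E) :
    ‖reindex g hg a‖ = ‖a‖ := by
  have h2 : 0 < (2 : ENNReal).toReal := by norm_num
  rw [lp.norm_eq_tsum_rpow h2, lp.norm_eq_tsum_rpow h2]
  congr 1
  rw [← hg.tsum_eq]
  · exact tsum_congr fun n => by simp [reindex, hg.extend_apply]
  · intro n hn
    by_contra hn'
    apply hn
    change ‖Function.extend g a 0 n‖ ^ _ = 0
    rw [Function.extend_apply' _ _ _ (by simpa using hn')]
    simp

theorem powerSeries_reindex (g : ℕ × ℕ → ℕ × ℕ) (hg : Function.Injective g)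
    (c : UnitDisc × UnitDisc → ℂ)
    (hc : ∀ p n, (p.1 : ℂ) ^ (g n).1 * (p.2 : ℂ) ^ (g n).2 =
      c p * ((p.1 : ℂ) ^ n.1 * (p.2 : ℂ) ^ n.2))
    (a : Coeff E) (p : UnitDisc × UnitDisc) :
    powerSeries (reindex g hg a) p = c p • powerSeries a p := by
  change ∑' n : ℕ × ℕ, _ • (Function.extend g a 0 n) = c p • ∑' n : ℕ × ℕ, _
  rw [← (summable_powerSeries a p).tsum_const_smul, ← hg.tsum_eq]
  · exact tsum_congr fun n => by rw [hg.extend_apply, hc, mul_smul]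
  · intro n hn
    by_contra hn'
    apply hn
    change _ • Function.extend g a 0 n = 0
    rw [Function.extend_apply' _ _ _ (by simpa using hn')]
    simp

/-- Multiplication by a function `c` on the bidisc, where multiplication by `c` takes
the monomial of index `n` to the monomial of index `g n`. -/
def mulOp (g : ℕ × ℕ → ℕ × ℕ) (hg : Function.Injective g)
    (c : UnitDisc × UnitDisc → ℂ)
    (hc : ∀ p n, (p.1 : ℂ) ^ (g n).1 * (p.2 : ℂ) ^ (g n).2 =
      c p * ((p.1 : ℂ) ^ n.1 * (p.2 : ℂ) ^ n.2)) : Hardy E →ₗᵢ[ℂ] Hardy E where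
  toFun f := ⟨fun p => c p • f p, reindex g hg (coeffIso E f), by
    funext p
    rw [powerSeries_reindex g hg c hc]
    congr 1
    exact (apply_eq_tsum f p).symm⟩
  map_add' f f' := ext fun p => smul_add (c p) (f p) (f' p)
  map_smul' r f := ext fun p => smul_comm (c p) r (f p)
  norm_map' f := by
    have h : ∀ x : Hardy E, ‖x‖ = ‖coeffIso E x‖ := fun x =>
      ((coeffIso E).norm_map x).symm
    rw [h f, ← norm_reindex g hg, h]
    congr 1
    apply powerSeries_injective
    funext p
    rw [powerSeries_reindex g hg c hc]
    refine (apply_eq_tsum _ p).symm.trans ?_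
    change c p • f p = c p • _
    congr 1
    exact apply_eq_tsum f p

variable (E)

/-- The operator `M_{z₁}` of multiplication by the first coordinate. -/
def M₁ : Hardy E →L[ℂ] Hardy E :=
  (mulOp (fun n => (n.1 + 1, n.2)) (fun a b h => by simpa [Prod.ext_iff] using h)
    (fun p => (p.1 : ℂ)) (fun p n => by ring)).toContinuousLinearMap

/-- The operator `M_{z₂}` of multiplication by the second coordinate. -/
def M₂ : Hardy E →L[ℂ] Hardy E :=
  (mulOp (fun n => (n.1, n.2 + 1)) (fun a b h => by simpa [Prod.ext_iff] using h)
    (fun p => (p.2 : ℂ)) (fun p n => by ring)).toContinuousLinearMap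

variable {E}

theorem M₁_apply (f : Hardy E) (p : UnitDisc × UnitDisc) : M₁ E f p = (p.1 : ℂ) • f p := rfl

theorem M₂_apply (f : Hardy E) (p : UnitDisc × UnitDisc) : M₂ E f p = (p.2 : ℂ) • f p := rfl

end Hardy

end Hardy

/-! ### Shift operators and `q`-commutativity -/

section Operators

open ContinuousLinearMap

variable {H : Type u} [NormedAddCommGroup H] [InnerProductSpace ℂ H] [CompleteSpace H]
variable {K : Type v} [NormedAddCommGroup K] [InnerProductSpace ℂ K] [CompleteSpace K]

/-- A shift operator: an isometry `V` with `V*ⁿ → 0` in the strong operator topology. -/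
def IsShift (V : H →L[ℂ] H) : Prop :=
  (∀ x, ‖V x‖ = ‖x‖) ∧ ∀ x, Tendsto (fun n : ℕ => (adjoint V ^ n) x) atTop (𝓝 0)

/-- `V₁ V₂ = q V₂ V₁`. -/
def IsQCommutative (q : ℂ) (V₁ V₂ : H →L[ℂ] H) : Prop :=
  V₁ * V₂ = q • (V₂ * V₁)

/-- `V₁ V₂ = q V₂ V₁` and `V₂ V₁* = q V₁* V₂`. -/
def IsDoublyQCommutative (q : ℂ) (V₁ V₂ : H →L[ℂ] H) : Prop :=
  IsQCommutative q V₁ V₂ ∧ V₂ * adjoint V₁ = q • (adjoint V₁ * V₂)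

/-- Joint unitary equivalence of the pairs `(V₁, V₂)` and `(W₁, W₂)`. -/
def PairUnitarilyEquivalent (V₁ V₂ : H →L[ℂ] H) (W₁ W₂ : K →L[ℂ] K) : Prop :=
  ∃ τ : H ≃ₗᵢ[ℂ] K, (∀ h, τ (V₁ h) = W₁ (τ h)) ∧ ∀ h, τ (V₂ h) = W₂ (τ h)

/-- `R` is the rotation by `q` along the shift `V`, that is,
`R h = D h + q V D V* h + q² V² D V*² h + ⋯`, where `D` is the defect operator of `V*`.
For an isometry `V`, the operator `1 - V V*` is a projection, so it equals its own positive
square root, which is `D`. -/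
def IsRotationAlong (q : ℂ) (V R : H →L[ℂ] H) : Prop :=
  ∀ h, HasSum (fun n : ℕ => q ^ n • (V ^ n) ((1 - V * adjoint V) ((adjoint V ^ n) h))) (R h)

/-- `(V₁, V₂)` is unitarily equivalent to `(M_{z₁} 𝔰_q, 𝔰_{q̄} M_{z₂})` on `H²(𝔻²; E)`, where
`𝔰_q` and `𝔰_{q̄}` are the unitaries which rotate by `q` and `q̄` along `M_{z₁} M_{z₂}`. -/
def HasTwistedHardyModel (q : ℂ) (V₁ V₂ : H →L[ℂ] H)
    (E : Type v) [NormedAddCommGroup E] [InnerProductSpace ℂ E] [CompleteSpace E] : Prop :=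
  ∃ s s' : Hardy E →L[ℂ] Hardy E,
    s ∈ unitary (Hardy E →L[ℂ] Hardy E) ∧ s' = star s ∧
    IsRotationAlong q (Hardy.M₁ E * Hardy.M₂ E) s ∧
    IsRotationAlong (conj q) (Hardy.M₁ E * Hardy.M₂ E) s' ∧
    PairUnitarilyEquivalent V₁ V₂ (Hardy.M₁ E * s) (s' * Hardy.M₂ E)

end Operators

end QShift

end

namespace QShift

/-! ### Taylor coefficients of the coordinate multiplications and their adjoints -/

namespace Hardy

variable {E : Type u} [NormedAddCommGroup E] [InnerProductSpace ℂ E] [CompleteSpace E]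

/-! On Taylor coefficients everything is explicit. With `M = M₁ M₂`, the operator `Mⁿ(1 - M M*)M*ⁿ`
keeps exactly the coefficients with `min i j = n`, so the rotation by `q` is the diagonal operator
`a_{ij} ↦ q^{min i j} a_{ij}` (`isRotationAlong_diagonal`). The model is then a pair of weighted
shifts, whose relations and wandering subspace are read off coefficientwise.

Conversely, for a doubly `q`-commutative pair of shifts let `W = ker V₁* ∩ ker V₂*`. The relations
make `V₂*` commute with the projection `1 - V₁V₁*` (`commute_adjoint_defect`); a Wold argument
applied once for each shift then shows that `H` is the Hilbert sum of the spaces `V₁ⁱV₂ʲW`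
(`inner_translates`, `eq_zero_of_inner_translates`). Sending `z₁ⁱz₂ʲa` to `V₁ⁱV₂ʲa` would intertwine
the pairs up to powers of `q`; the unimodular factor `phase` corrects these. Thus the coefficient
space can be taken to be `W`, and it is `ℂ` exactly when `dim W = 1`. -/

theorem ext_coeff {f g : Hardy E} (h : ∀ i j, coeffIso E f (i, j) = coeffIso E g (i, j)) :
    f = g :=
  (coeffIso E).injective (lp.ext (funext fun n => h n.1 n.2))

/-- The monomial `z₁ⁱ z₂ʲ a`. -/
noncomputable def monomial (n : ℕ × ℕ) (a : E) : Hardy E :=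
  (coeffIso E).symm (lp.single 2 n a)

theorem coeff_monomial (n m : ℕ × ℕ) (a : E) :
    coeffIso E (monomial n a) m = if m = n then a else 0 := by
  rw [monomial, LinearIsometryEquiv.apply_symm_apply, lp.single_apply, Pi.single_apply]

theorem inner_monomial_left (n : ℕ × ℕ) (a : E) (f : Hardy E) :
    inner ℂ (monomial n a) f = inner ℂ a (coeffIso E f n) := by
  rw [← (coeffIso E).inner_map_map, monomial, LinearIsometryEquiv.apply_symm_apply,
    lp.inner_single_left]

theorem hasSum_monomial (f : Hardy E) :
    HasSum (fun n => monomial n (coeffIso E f n)) f := by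
  have h := (lp.hasSum_single (by norm_num) (coeffIso E f)).mapL
    ((coeffIso E).symm.toContinuousLinearEquiv : Coeff E →L[ℂ] Hardy E)
  simpa [monomial] using h

theorem clm_ext {F : Type v} [NormedAddCommGroup F] [NormedSpace ℂ F] {A B : Hardy E →L[ℂ] F}
    (h : ∀ i j a, A (monomial (i, j) a) = B (monomial (i, j) a)) : A = B := by
  ext f
  refine ((hasSum_monomial f).mapL A).unique ?_
  simpa only [h] using! (hasSum_monomial f).mapL B

theorem coeffIso_mulOp (g : ℕ × ℕ → ℕ × ℕ) (hg : Function.Injective g)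
    (c : UnitDisc × UnitDisc → ℂ)
    (hc : ∀ p n, (p.1 : ℂ) ^ (g n).1 * (p.2 : ℂ) ^ (g n).2 =
      c p * ((p.1 : ℂ) ^ n.1 * (p.2 : ℂ) ^ n.2)) (f : Hardy E) :
    coeffIso E (mulOp g hg c hc f) = reindex g hg (coeffIso E f) := by
  apply powerSeries_injective
  funext p
  rw [powerSeries_reindex g hg c hc]
  refine (apply_eq_tsum _ p).symm.trans ?_
  change c p • f p = c p • _
  congr 1
  exact apply_eq_tsum f p

theorem coeff_M₁_succ (f : Hardy E) (i j : ℕ) :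
    coeffIso E (M₁ E f) (i + 1, j) = coeffIso E f (i, j) := by
  refine (congrFun (congrArg Subtype.val (coeffIso_mulOp (fun n => (n.1 + 1, n.2))
    (fun a b h => by simpa [Prod.ext_iff] using h) (fun p => (p.1 : ℂ)) (fun p n => by ring)
    f)) _).trans ?_
  exact Function.Injective.extend_apply
    (f := fun n : ℕ × ℕ => (n.1 + 1, n.2)) (fun a b h => by simpa [Prod.ext_iff] using h) _ _ (i, j)

theorem coeff_M₁_zero (f : Hardy E) (j : ℕ) : coeffIso E (M₁ E f) (0, j) = 0 := by
  refine (congrFun (congrArg Subtype.val (coeffIso_mulOp (fun n => (n.1 + 1, n.2))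
    (fun a b h => by simpa [Prod.ext_iff] using h) (fun p => (p.1 : ℂ)) (fun p n => by ring)
    f)) _).trans ?_
  exact Function.extend_apply' _ _ _ (by simp)

theorem coeff_M₂_succ (f : Hardy E) (i j : ℕ) :
    coeffIso E (M₂ E f) (i, j + 1) = coeffIso E f (i, j) := by
  refine (congrFun (congrArg Subtype.val (coeffIso_mulOp (fun n => (n.1, n.2 + 1))
    (fun a b h => by simpa [Prod.ext_iff] using h) (fun p => (p.2 : ℂ)) (fun p n => by ring)
    f)) _).trans ?_
  exact Function.Injective.extend_apply
    (f := fun n : ℕ × ℕ => (n.1, n.2 + 1)) (fun a b h => by simpa [Prod.ext_iff] using h) _ _ (i, j)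

theorem coeff_M₂_zero (f : Hardy E) (i : ℕ) : coeffIso E (M₂ E f) (i, 0) = 0 := by
  refine (congrFun (congrArg Subtype.val (coeffIso_mulOp (fun n => (n.1, n.2 + 1))
    (fun a b h => by simpa [Prod.ext_iff] using h) (fun p => (p.2 : ℂ)) (fun p n => by ring)
    f)) _).trans ?_
  exact Function.extend_apply' _ _ _ (by simp)

theorem M₁_monomial (i j : ℕ) (a : E) : M₁ E (monomial (i, j) a) = monomial (i + 1, j) a := by
  refine ext_coeff fun k l => ?_
  cases k <;> simp [coeff_M₁_succ, coeff_M₁_zero, coeff_monomial]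

theorem M₂_monomial (i j : ℕ) (a : E) : M₂ E (monomial (i, j) a) = monomial (i, j + 1) a := by
  refine ext_coeff fun k l => ?_
  cases l <;> simp [coeff_M₂_succ, coeff_M₂_zero, coeff_monomial]

open ContinuousLinearMap

theorem coeff_adjoint_M₁ (f : Hardy E) (i j : ℕ) :
    coeffIso E (adjoint (M₁ E) f) (i, j) = coeffIso E f (i + 1, j) := by
  refine ext_inner_left ℂ fun a => ?_
  rw [← inner_monomial_left, adjoint_inner_right, M₁_monomial, inner_monomial_left]

theorem coeff_adjoint_M₂ (f : Hardy E) (i j : ℕ) :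
    coeffIso E (adjoint (M₂ E) f) (i, j) = coeffIso E f (i, j + 1) := by
  refine ext_inner_left ℂ fun a => ?_
  rw [← inner_monomial_left, adjoint_inner_right, M₂_monomial, inner_monomial_left]

/-! ### Wold decomposition along `M₁ M₂` -/

theorem coeff_adjoint_mul_pow (f : Hardy E) (n i j : ℕ) :
    coeffIso E ((adjoint (M₁ E * M₂ E) ^ n) f) (i, j) = coeffIso E f (i + n, j + n) := by
  induction n generalizing i j with
  | zero => rfl
  | succ n ih =>
    have h : adjoint (M₁ E * M₂ E) = adjoint (M₂ E) * adjoint (M₁ E) := star_mul _ _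
    rw [pow_succ', mul_apply_eq_comp]
    conv_lhs => rw [h, mul_apply_eq_comp, ← h]
    rw [coeff_adjoint_M₂, coeff_adjoint_M₁, ih]
    rw [add_assoc, add_assoc, add_comm 1 n]

theorem coeff_mul_pow_add (f : Hardy E) (n i j : ℕ) :
    coeffIso E (((M₁ E * M₂ E) ^ n) f) (i + n, j + n) = coeffIso E f (i, j) := by
  induction n with
  | zero => rfl
  | succ n ih =>
    rw [pow_succ', mul_apply_eq_comp, mul_apply_eq_comp, ← add_assoc, ← add_assoc, coeff_M₁_succ,
      coeff_M₂_succ, ih]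

theorem coeff_mul_pow_of_lt (f : Hardy E) {n i j : ℕ} (h : min i j < n) :
    coeffIso E (((M₁ E * M₂ E) ^ n) f) (i, j) = 0 := by
  induction n generalizing i j with
  | zero => simp at h
  | succ n ih =>
    rw [pow_succ', mul_apply_eq_comp, mul_apply_eq_comp]
    obtain _ | i := i
    · rw [coeff_M₁_zero]
    rw [coeff_M₁_succ]
    obtain _ | j := j
    · rw [coeff_M₂_zero]
    rw [coeff_M₂_succ, ih (by omega)]

theorem coeff_defect (f : Hardy E) (i j : ℕ) :
    coeffIso E ((1 - (M₁ E * M₂ E) * adjoint (M₁ E * M₂ E)) f) (i, j) =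
      if min i j = 0 then coeffIso E f (i, j) else 0 := by
  have h1 := coeff_adjoint_mul_pow f 1
  simp only [pow_one] at h1
  rw [sub_apply, map_sub, one_apply_eq_self, mul_apply_eq_comp, lp.coeFn_sub, Pi.sub_apply]
  split_ifs with h
  · have := coeff_mul_pow_of_lt (adjoint (M₁ E * M₂ E) f) (n := 1) (i := i) (j := j) (by omega)
    rw [pow_one] at this
    rw [this, sub_zero]
  · obtain ⟨i, rfl⟩ := Nat.exists_eq_add_of_le' (show 1 ≤ i by omega)
    obtain ⟨j, rfl⟩ := Nat.exists_eq_add_of_le' (show 1 ≤ j by omega)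
    have := coeff_mul_pow_add (adjoint (M₁ E * M₂ E) f) 1 i j
    rw [pow_one] at this
    rw [this, h1, sub_self]

/-- The `n`-th term of the rotation along `M_{z₁} M_{z₂}` keeps the coefficients with
`min i j = n`. -/
theorem coeff_wold_component (f : Hardy E) (n i j : ℕ) :
    coeffIso E (((M₁ E * M₂ E) ^ n) ((1 - (M₁ E * M₂ E) * adjoint (M₁ E * M₂ E))
      ((adjoint (M₁ E * M₂ E) ^ n) f))) (i, j) =
      if min i j = n then coeffIso E f (i, j) else 0 := by
  rcases lt_or_ge (min i j) n with h | h
  · rw [coeff_mul_pow_of_lt _ h, if_neg h.ne]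
  · obtain ⟨i, rfl⟩ := Nat.exists_eq_add_of_le' (show n ≤ i by omega)
    obtain ⟨j, rfl⟩ := Nat.exists_eq_add_of_le' (show n ≤ j by omega)
    rw [coeff_mul_pow_add, coeff_defect, coeff_adjoint_mul_pow]
    congr 1
    rw [eq_iff_iff]
    omega

/-! ### Rotations as diagonal operators -/

theorem summable_norm_coeff (f : Hardy E) :
    Summable fun n : ℕ × ℕ => ‖coeffIso E f n‖ ^ (2 : ENNReal).toReal :=
  (memℓp_gen_iff (by norm_num)).1 (lp.memℓp _)

/-- The operator multiplying the Taylor coefficient of index `n` by the unimodular number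
`w n`. -/
noncomputable def diagonal (w : ℕ × ℕ → Circle) : Hardy E →L[ℂ] Hardy E :=
  LinearIsometry.toContinuousLinearMap
    { toFun := fun f => (coeffIso E).symm ⟨fun n => (w n : ℂ) • coeffIso E f n,
        (memℓp_gen_iff (by norm_num)).2 (by
          simpa only [norm_smul, Circle.norm_coe, one_mul] using summable_norm_coeff f)⟩
      map_add' := fun f g => by
        rw [← map_add]
        congr 1
        ext n
        exact (by simp : (w n : ℂ) • coeffIso E (f + g) n =
          (w n : ℂ) • coeffIso E f n + (w n : ℂ) • coeffIso E g n)
      map_smul' := fun c f => by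
        apply (coeffIso E).injective
        ext n
        simp [smul_comm c]
      norm_map' := fun f => by
        have h2 : 0 < (2 : ENNReal).toReal := by norm_num
        change ‖(coeffIso E).symm _‖ = _
        rw [LinearIsometryEquiv.norm_map, ← (coeffIso E).norm_map f, lp.norm_eq_tsum_rpow h2,
          lp.norm_eq_tsum_rpow h2]
        simp only [norm_smul, Circle.norm_coe, one_mul] }

theorem coeff_diagonal (w : ℕ × ℕ → Circle) (f : Hardy E) (n : ℕ × ℕ) :
    coeffIso E (diagonal w f) n = (w n : ℂ) • coeffIso E f n := by
  change coeffIso E ((coeffIso E).symm _) n = _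
  rw [LinearIsometryEquiv.apply_symm_apply]

theorem star_diagonal (w : ℕ × ℕ → Circle) :
    star (diagonal w : Hardy E →L[ℂ] Hardy E) = diagonal w⁻¹ := by
  rw [star_eq_adjoint, eq_comm, eq_adjoint_iff]
  intro f g
  rw [← (coeffIso E).inner_map_map, ← (coeffIso E).inner_map_map f, lp.inner_eq_tsum,
    lp.inner_eq_tsum]
  refine tsum_congr fun n => ?_
  rw [coeff_diagonal, coeff_diagonal, inner_smul_left, inner_smul_right, Pi.inv_apply,
    Circle.coe_inv_eq_conj, conj_conj]

theorem diagonal_mem_unitary (w : ℕ × ℕ → Circle) :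
    (diagonal w : Hardy E →L[ℂ] Hardy E) ∈ unitary (Hardy E →L[ℂ] Hardy E) := by
  rw [Unitary.mem_iff, star_diagonal]
  constructor <;> ext f <;> refine ext_coeff fun i j => ?_ <;>
    simp [coeff_diagonal, smul_smul]

theorem isRotationAlong_diagonal (q : Circle) :
    IsRotationAlong (q : ℂ) (M₁ E * M₂ E)
      (diagonal fun n => q ^ min n.1 n.2 : Hardy E →L[ℂ] Hardy E) := by
  intro f
  set S : Hardy E →L[ℂ] Hardy E := diagonal fun n => q ^ min n.1 n.2 with hS
  have h := hasSum_monomial (S f)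
  -- Group the monomial expansion of `S f` by the value of `min i j`; the group with value `n` sums
  -- to the `n`-th term of the rotation series.
  rw [← (Equiv.sigmaFiberEquiv fun n : ℕ × ℕ => min n.1 n.2).hasSum_iff] at h
  refine h.sigma fun n => ?_
  have hn := hasSum_monomial ((q : ℂ) ^ n • ((M₁ E * M₂ E) ^ n)
    ((1 - (M₁ E * M₂ E) * adjoint (M₁ E * M₂ E)) ((adjoint (M₁ E * M₂ E) ^ n) f)))
  refine ((hasSum_subtype_iff_indicator (s := {m : ℕ × ℕ | min m.1 m.2 = n})
    (f := fun m => monomial m (coeffIso E (S f) m))).2 ?_)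
  convert hn using 1
  funext ⟨i, j⟩
  rw [map_smul, lp.coeFn_smul, Pi.smul_apply, coeff_wold_component, Set.indicator_apply, hS,
    coeff_diagonal]
  by_cases h : min i j = n
  · simp [h]
  · simp [h, monomial]

theorem eq_diagonal_of_isRotationAlong {q : Circle} {s : Hardy E →L[ℂ] Hardy E}
    (h : IsRotationAlong (q : ℂ) (M₁ E * M₂ E) s) : s = diagonal fun n => q ^ min n.1 n.2 :=
  ContinuousLinearMap.ext fun f => (h f).unique (isRotationAlong_diagonal q f)

/-! ### The model pair -/

theorem star_rotation (q : Circle) :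
    star (diagonal (fun n => q ^ min n.1 n.2) : Hardy E →L[ℂ] Hardy E) =
      diagonal fun n => q⁻¹ ^ min n.1 n.2 := by
  rw [star_diagonal]
  congr 1
  funext n
  simp

/-- The model pair is doubly `q`-commutative. -/
theorem isDoublyQCommutative_model (q : Circle) :
    IsDoublyQCommutative (q : ℂ)
      (M₁ E * diagonal fun n => q ^ min n.1 n.2) ((diagonal fun n => q⁻¹ ^ min n.1 n.2) * M₂ E) := by
  have hq : (q : ℂ) ≠ 0 := q.coe_ne_zero
  constructor
  · ext f
    refine ext_coeff fun i j => ?_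
    obtain _ | i := i <;> obtain _ | j := j <;>
      simp [coeff_M₁_succ, coeff_M₂_succ, coeff_M₁_zero, coeff_M₂_zero, coeff_diagonal, smul_smul]
    -- In `V₁V₂` the two rotations cancel. In `V₂V₁` they are separated by `M₂M₁`, which raises `min
    -- i j` by one and leaves the factor `q⁻¹`.
    have hc : (q : ℂ) * (((q : ℂ) ^ (min i j + 1))⁻¹ * (q : ℂ) ^ min i j) = 1 := by
      rw [pow_succ]
      field_simp
    rw [hc, one_smul]
  · rw [← star_eq_adjoint, star_mul, star_rotation, star_eq_adjoint]
    ext f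
    refine ext_coeff fun i j => ?_
    obtain _ | j := j <;>
      simp [coeff_M₂_succ, coeff_M₂_zero, coeff_diagonal, coeff_adjoint_M₁, smul_smul]
    congr 1
    rw [pow_succ]
    field_simp

theorem finrank_wandering_model (q : Circle) :
    Module.finrank ℂ
      ↥(LinearMap.ker (adjoint (M₁ ℂ * diagonal fun n => q ^ min n.1 n.2)).toLinearMap ⊓
        LinearMap.ker (adjoint ((diagonal fun n => q⁻¹ ^ min n.1 n.2) * M₂ ℂ)).toLinearMap)
      = 1 := by
  have hq : (q : ℂ) ≠ 0 := q.coe_ne_zero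
  -- The adjoints are backward shifts with nonzero weights, so only the constant term survives in
  -- the joint kernel.
  have key : ∀ f : Hardy ℂ,
      f ∈ (LinearMap.ker (adjoint (M₁ ℂ * diagonal fun n => q ^ min n.1 n.2)).toLinearMap ⊓
        LinearMap.ker (adjoint ((diagonal fun n => q⁻¹ ^ min n.1 n.2) * M₂ ℂ)).toLinearMap) ↔
      ∀ i j, (i, j) ≠ (0, 0) → coeffIso ℂ f (i, j) = 0 := by
    intro f
    rw [Submodule.mem_inf, LinearMap.mem_ker, LinearMap.mem_ker]
    simp only [coe_coe]
    rw [← star_eq_adjoint, ← star_eq_adjoint, star_mul, star_mul, star_rotation, star_rotation,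
      star_eq_adjoint, star_eq_adjoint, inv_inv]
    constructor
    · rintro ⟨h1, h2⟩ i j hij
      obtain _ | i := i
      · obtain _ | j := j
        · exact absurd rfl hij
        · have := congrArg (fun g => coeffIso ℂ g (0, j)) h2
          simpa [coeff_diagonal, coeff_adjoint_M₂, hq] using this
      · have := congrArg (fun g => coeffIso ℂ g (i, j)) h1
        simpa [coeff_diagonal, coeff_adjoint_M₁, hq] using this
    · intro h
      constructor <;> refine ext_coeff fun i j => ?_ <;>
        simp [coeff_diagonal, coeff_adjoint_M₁, coeff_adjoint_M₂, h]
  refine finrank_eq_one_iff'.2 ⟨⟨monomial (0, 0) 1, (key _).2 fun i j hij => ?_⟩, ?_, ?_⟩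
  · rw [coeff_monomial, if_neg hij]
  · intro h
    have := congrArg (fun g => coeffIso ℂ g.1 (0, 0)) h
    simp [coeff_monomial] at this
  · rintro ⟨f, hf⟩
    refine ⟨coeffIso ℂ f (0, 0), Subtype.ext (ext_coeff fun i j => ?_)⟩
    change coeffIso ℂ (coeffIso ℂ f (0, 0) • monomial (0, 0) (1 : ℂ)) (i, j) = _
    by_cases hij : (i, j) = (0, 0)
    · simp [hij, coeff_monomial]
    · rw [(key f).1 hf i j hij]
      simp [hij, coeff_monomial]

end Hardy

open ContinuousLinearMap

/-! ### Shifts and their defect projections -/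

section Operators

variable {H : Type u} [NormedAddCommGroup H] [InnerProductSpace ℂ H] [CompleteSpace H]
variable {K : Type v} [NormedAddCommGroup K] [InnerProductSpace ℂ K] [CompleteSpace K]

theorem adjoint_pow_apply_comm (V : H →L[ℂ] H) (n : ℕ) (x y : H) :
    inner ℂ ((V ^ n) x) y = inner ℂ x ((adjoint V ^ n) y) := by
  rw [← adjoint_inner_right, ← star_eq_adjoint, ← star_eq_adjoint, star_pow]

theorem inner_defect (V : H →L[ℂ] H) (x y : H) :
    inner ℂ ((1 - V * adjoint V) x) y = inner ℂ x ((1 - V * adjoint V) y) := by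
  simp only [sub_apply, one_apply_eq_self, mul_apply_eq_comp, inner_sub_left, inner_sub_right]
  rw [← adjoint_inner_right, adjoint_inner_left]

namespace IsShift

variable {V : H →L[ℂ] H}

theorem norm_pow_apply (hV : IsShift V) (n : ℕ) (x : H) : ‖(V ^ n) x‖ = ‖x‖ := by
  induction n with
  | zero => rfl
  | succ n ih => rw [pow_succ', mul_apply_eq_comp, hV.1, ih]

theorem adjoint_apply_self (hV : IsShift V) (x : H) : adjoint V (V x) = x :=
  congrArg (fun A : H →L[ℂ] H => A x) ((norm_map_iff_adjoint_comp_self V).1 hV.1)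

theorem adjoint_defect (hV : IsShift V) (x : H) : adjoint V ((1 - V * adjoint V) x) = 0 := by
  simp [hV.adjoint_apply_self]

theorem inner_pow_pow (hV : IsShift V) (n : ℕ) (x y : H) :
    inner ℂ ((V ^ n) x) ((V ^ n) y) = inner ℂ x y := by
  induction n with
  | zero => rfl
  | succ n ih =>
    rw [pow_succ', mul_apply_eq_comp, mul_apply_eq_comp, ← adjoint_inner_right,
      hV.adjoint_apply_self, ih]

/-- A vector whose backward orbit has no component in `ker V*` is zero. -/
theorem eq_zero_of_defect (hV : IsShift V) {x : H}
    (h : ∀ n : ℕ, (1 - V * adjoint V) ((adjoint V ^ n) x) = 0) : x = 0 := by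
  -- A zero defect means `V V*` fixes each `V*ⁿx`, so `V*` preserves norms along the orbit, whereas
  -- the orbit tends to zero.
  have hn : ∀ n : ℕ, ‖(adjoint V ^ n) x‖ = ‖x‖ := by
    intro n
    induction n with
    | zero => rfl
    | succ n ih =>
      have := h n
      rw [sub_apply, one_apply_eq_self, mul_apply_eq_comp, sub_eq_zero] at this
      rw [← ih, pow_succ', mul_apply_eq_comp, ← hV.1, ← this]
  have := (hV.2 x).norm
  simp only [hn, norm_zero] at this
  exact norm_eq_zero.1 (tendsto_nhds_unique tendsto_const_nhds this)

/-- After cancelling `Vⁿ`, at least one factor `V` remains on the right, and its adjoint kills `x`.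
-/
theorem inner_pow_pow_add (hV : IsShift V) {x : H} (hx : adjoint V x = 0) (n m : ℕ) (y : H) :
    inner ℂ ((V ^ n) x) ((V ^ (n + m + 1)) y) = 0 := by
  rw [add_assoc, pow_add, mul_apply_eq_comp, hV.inner_pow_pow, pow_succ', mul_apply_eq_comp,
    ← adjoint_inner_left, hx, inner_zero_left]

end IsShift

/-- The joint wandering subspace `ker V₁* ∩ ker V₂*`. -/
noncomputable abbrev wandering (V₁ V₂ : H →L[ℂ] H) : Submodule ℂ H :=
  LinearMap.ker (adjoint V₁).toLinearMap ⊓ LinearMap.ker (adjoint V₂).toLinearMap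

theorem mem_wandering {V₁ V₂ : H →L[ℂ] H} {x : H} :
    x ∈ wandering V₁ V₂ ↔ adjoint V₁ x = 0 ∧ adjoint V₂ x = 0 := Iff.rfl

instance (V₁ V₂ : H →L[ℂ] H) : CompleteSpace (wandering V₁ V₂) :=
  ((adjoint V₁).isClosed_ker.inter (adjoint V₂).isClosed_ker).completeSpace_coe

/-! ### Wold decomposition of a doubly `q`-commutative pair -/

namespace IsDoublyQCommutative

variable {q : Circle} {V₁ V₂ : H →L[ℂ] H}

theorem adjoint_apply (h : IsDoublyQCommutative (q : ℂ) V₁ V₂) (x : H) :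
    adjoint V₁ (V₂ x) = (q⁻¹ : Circle) • V₂ (adjoint V₁ x) := by
  have := congrArg (fun A : H →L[ℂ] H => A x) h.2
  rw [mul_apply_eq_comp, smul_apply, mul_apply_eq_comp] at this
  rw [this]
  exact (inv_smul_smul q _).symm

theorem apply_pow (h : IsDoublyQCommutative (q : ℂ) V₁ V₂) (n : ℕ) (x : H) :
    V₂ ((V₁ ^ n) x) = (q⁻¹ ^ n : Circle) • (V₁ ^ n) (V₂ x) := by
  have h1 : ∀ x, V₂ (V₁ x) = (q⁻¹ : Circle) • V₁ (V₂ x) := fun x => by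
    have := congrArg (fun A : H →L[ℂ] H => A x) h.1
    rw [mul_apply_eq_comp, smul_apply, mul_apply_eq_comp] at this
    rw [this]
    exact (inv_smul_smul q _).symm
  induction n with
  | zero => simp
  | succ n ih =>
    rw [pow_succ', mul_apply_eq_comp, mul_apply_eq_comp, h1, ih, pow_succ', mul_smul]
    simp only [Circle.smul_def, map_smul]

theorem adjoint_pow_eq_zero (h : IsDoublyQCommutative (q : ℂ) V₁ V₂) {x : H}
    (hx : adjoint V₁ x = 0) (n : ℕ) : adjoint V₁ ((V₂ ^ n) x) = 0 := by
  induction n with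
  | zero => exact hx
  | succ n ih => rw [pow_succ', mul_apply_eq_comp, h.adjoint_apply, ih, map_zero, smul_zero]

/-- Moving `V₂*` past `V₁` costs `q` and past `V₁*` costs `q̄`; the two cancel in `V₁V₁*` because
`|q| = 1`. -/
theorem commute_adjoint_defect (h : IsDoublyQCommutative (q : ℂ) V₁ V₂) :
    Commute (adjoint V₂) (1 - V₁ * adjoint V₁) := by
  refine (Commute.one_right _).sub_right ?_
  have h1 := congrArg star h.1
  have h2 := congrArg star h.2
  simp only [star_smul, star_mul, star_eq_adjoint, adjoint_adjoint] at h1 h2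
  have hq : (q : ℂ) * star (q : ℂ) = 1 := by
    rw [Complex.star_def, Complex.mul_conj, Circle.normSq_coe, Complex.ofReal_one]
  have h3 : adjoint V₂ * V₁ = (q : ℂ) • (V₁ * adjoint V₂) := by
    rw [h2, smul_smul, hq, one_smul]
  rw [Commute, SemiconjBy, ← mul_assoc, h3, smul_mul_assoc, mul_assoc, h1, mul_smul_comm,
    smul_smul, hq, one_smul, mul_assoc]

theorem defect_defect_mem_wandering (h : IsDoublyQCommutative (q : ℂ) V₁ V₂) (h₁ : IsShift V₁)
    (h₂ : IsShift V₂) (x : H) :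
    (1 - V₁ * adjoint V₁) ((1 - V₂ * adjoint V₂) x) ∈ wandering V₁ V₂ := by
  refine mem_wandering.2 ⟨h₁.adjoint_defect _, ?_⟩
  rw [← mul_apply_eq_comp, h.commute_adjoint_defect.eq, mul_apply_eq_comp, h₂.adjoint_defect,
    map_zero]

/-- The translates of the joint wandering subspace span a dense subspace. -/
theorem eq_zero_of_inner_translates (h : IsDoublyQCommutative (q : ℂ) V₁ V₂) (h₁ : IsShift V₁)
    (h₂ : IsShift V₂) {x : H}
    (hx : ∀ i j : ℕ, ∀ w ∈ wandering V₁ V₂, inner ℂ ((V₁ ^ i) ((V₂ ^ j) w)) x = 0) : x = 0 := by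
  refine h₁.eq_zero_of_defect fun i => h₂.eq_zero_of_defect fun j => ?_
  rw [← mul_apply_eq_comp (adjoint V₂ ^ j), (h.commute_adjoint_defect.pow_left j).eq,
    mul_apply_eq_comp]
  -- Moving both defects and all the powers onto `y` pairs `x` with a translate of a vector of the
  -- wandering subspace.
  refine ext_inner_left ℂ fun y => ?_
  rw [← inner_defect, ← inner_defect, ← adjoint_pow_apply_comm, ← adjoint_pow_apply_comm,
    inner_zero_right]
  exact hx i j _ (h.defect_defect_mem_wandering h₁ h₂ y)

/-- Powers of `V₂` preserve `ker V₁*`, so different powers of `V₁` already give orthogonality. For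
equal powers, cancel them and argue with `V₂` alone. -/
theorem inner_translates (h : IsDoublyQCommutative (q : ℂ) V₁ V₂) (h₁ : IsShift V₁)
    (h₂ : IsShift V₂) {w w' : H} (hw : w ∈ wandering V₁ V₂) (hw' : w' ∈ wandering V₁ V₂)
    {n m : ℕ × ℕ} (hnm : n ≠ m) :
    inner ℂ ((V₁ ^ n.1) ((V₂ ^ n.2) w)) ((V₁ ^ m.1) ((V₂ ^ m.2) w')) = 0 := by
  obtain ⟨i, j⟩ := n
  obtain ⟨k, l⟩ := m
  rcases lt_trichotomy i k with hik | rfl | hik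
  · obtain ⟨d, rfl⟩ := Nat.exists_eq_add_of_lt hik
    exact h₁.inner_pow_pow_add (h.adjoint_pow_eq_zero (mem_wandering.1 hw).1 j) _ _ _
  · rw [h₁.inner_pow_pow]
    rcases lt_trichotomy j l with hjl | rfl | hjl
    · obtain ⟨d, rfl⟩ := Nat.exists_eq_add_of_lt hjl
      exact h₂.inner_pow_pow_add (mem_wandering.1 hw).2 _ _ _
    · exact absurd rfl hnm
    · obtain ⟨d, rfl⟩ := Nat.exists_eq_add_of_lt hjl
      rw [← inner_conj_symm, h₂.inner_pow_pow_add (mem_wandering.1 hw').2, map_zero]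
  · obtain ⟨d, rfl⟩ := Nat.exists_eq_add_of_lt hik
    rw [← inner_conj_symm,
      h₁.inner_pow_pow_add (h.adjoint_pow_eq_zero (mem_wandering.1 hw').1 l), map_zero]

end IsDoublyQCommutative

/-- The phase with which the monomial `z₁ⁱ z₂ʲ a` is sent to the translate `V₁ⁱ V₂ʲ a`. -/
noncomputable def phase (q : Circle) (n : ℕ × ℕ) : Circle :=
  q⁻¹ ^ ∑ k ∈ Finset.range n.1, min k n.2

/-- The recurrence needed to intertwine `V₁` with `M₁ 𝔰_q`; with value `1` at `i = 0` it determines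
`phase`. -/
theorem phase_succ_left (q : Circle) (i j : ℕ) :
    q ^ min i j * phase q (i + 1, j) = phase q (i, j) := by
  rw [phase, phase, Finset.sum_range_succ, pow_add, mul_left_comm, ← mul_pow, mul_inv_cancel,
    one_pow, mul_one]

/-- The condition for `V₂`, where `q⁻ⁱ` is the cost of moving `V₂` past `V₁ⁱ`. It holds since
raising `j` by one raises `min k j` for exactly `i - min i (j + 1)` indices `k < i`. -/
theorem phase_succ_right (q : Circle) (i j : ℕ) :
    q⁻¹ ^ min i (j + 1) * phase q (i, j + 1) = q⁻¹ ^ i * phase q (i, j) := by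
  rw [phase, phase, ← pow_add, ← pow_add]
  congr 1
  induction i with
  | zero => simp
  | succ i ih =>
    rw [Finset.sum_range_succ, Finset.sum_range_succ]
    dsimp only at ih ⊢
    omega

/-! ### The unitary onto the Hardy space -/

section Model

variable {E : Type v} [NormedAddCommGroup E] [InnerProductSpace ℂ E]
variable {q : Circle} {V₁ V₂ : H →L[ℂ] H}

/-- The embeddings `a ↦ V₁ⁱ V₂ʲ a` of the joint wandering subspace, with phases. -/
noncomputable def translate (q : Circle) (h₁ : IsShift V₁) (h₂ : IsShift V₂)
    (φ : E ≃ₗᵢ[ℂ] wandering V₁ V₂)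
    (n : ℕ × ℕ) : E →ₗᵢ[ℂ] H where
  toFun a := phase q n • (V₁ ^ n.1) ((V₂ ^ n.2) (φ a))
  map_add' a b := by simp
  map_smul' c a := by simp [Circle.smul_def, smul_comm c]
  norm_map' a := by
    change ‖phase q n • (V₁ ^ n.1) ((V₂ ^ n.2) (φ a : H))‖ = _
    rw [Circle.smul_def, norm_smul, Circle.norm_coe, one_mul, h₁.norm_pow_apply,
      h₂.norm_pow_apply]
    exact φ.norm_map a

theorem translate_apply (h₁ : IsShift V₁) (h₂ : IsShift V₂) (φ : E ≃ₗᵢ[ℂ] wandering V₁ V₂)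
    (n : ℕ × ℕ) (a : E) :
    translate q h₁ h₂ φ n a = phase q n • (V₁ ^ n.1) ((V₂ ^ n.2) (φ a)) := rfl

variable [CompleteSpace E]

theorem IsDoublyQCommutative.isHilbertSum_translate (h : IsDoublyQCommutative (q : ℂ) V₁ V₂)
    (h₁ : IsShift V₁) (h₂ : IsShift V₂) (φ : E ≃ₗᵢ[ℂ] wandering V₁ V₂) :
    IsHilbertSum ℂ (fun _ : ℕ × ℕ => E) (translate q h₁ h₂ φ) := by
  refine IsHilbertSum.mk (fun n m hnm a b => ?_) ?_
  · rw [translate_apply, translate_apply, Circle.smul_def, Circle.smul_def, inner_smul_left,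
      inner_smul_right, h.inner_translates h₁ h₂ (φ a).2 (φ b).2 hnm, mul_zero, mul_zero]
  · rw [top_le_iff, Submodule.topologicalClosure_eq_top_iff, Submodule.eq_bot_iff]
    intro x hx
    refine h.eq_zero_of_inner_translates h₁ h₂ fun i j w hw => ?_
    have := (Submodule.mem_orthogonal _ _).1 hx (translate q h₁ h₂ φ (i, j) (φ.symm ⟨w, hw⟩))
      (Submodule.mem_iSup_of_mem (i, j) (LinearMap.mem_range_self _ _))
    rw [translate_apply, Circle.smul_def, inner_smul_left, φ.apply_symm_apply] at this
    exact (mul_eq_zero.1 this).resolve_left (by simp)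

theorem Hardy.diagonal_monomial (w : ℕ × ℕ → Circle) (n : ℕ × ℕ) (a : E) :
    Hardy.diagonal w (Hardy.monomial n a) = (w n : ℂ) • Hardy.monomial n a := by
  refine Hardy.ext_coeff fun i j => ?_
  rw [map_smul, Hardy.coeff_diagonal, lp.coeFn_smul, Pi.smul_apply, Hardy.coeff_monomial]
  split_ifs with hn
  · rw [hn]
  · rw [smul_zero, smul_zero]

theorem IsDoublyQCommutative.pairUnitarilyEquivalent (h : IsDoublyQCommutative (q : ℂ) V₁ V₂)
    (h₁ : IsShift V₁) (h₂ : IsShift V₂) (φ : E ≃ₗᵢ[ℂ] wandering V₁ V₂) :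
    PairUnitarilyEquivalent V₁ V₂ (Hardy.M₁ E * Hardy.diagonal fun n => q ^ min n.1 n.2)
      ((Hardy.diagonal fun n => q⁻¹ ^ min n.1 n.2) * Hardy.M₂ E) := by
  set τ := (h.isHilbertSum_translate h₁ h₂ φ).linearIsometryEquiv.trans (Hardy.coeffIso E).symm
    with hτ
  have hm : ∀ n a, τ.symm (Hardy.monomial n a) = translate q h₁ h₂ φ n a := by
    intro n a
    rw [hτ, LinearIsometryEquiv.symm_trans, LinearIsometryEquiv.trans_apply, Hardy.monomial,
      LinearIsometryEquiv.symm_symm, LinearIsometryEquiv.apply_symm_apply,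
      IsHilbertSum.linearIsometryEquiv_symm_apply_single]
  let U : Hardy E →L[ℂ] H := τ.symm.toContinuousLinearEquiv
  -- By continuity, an intertwining relation need only be checked on monomials.
  have key : ∀ (A : H →L[ℂ] H) (B : Hardy E →L[ℂ] Hardy E),
      (∀ i j a, A (τ.symm (Hardy.monomial (i, j) a)) = τ.symm (B (Hardy.monomial (i, j) a))) →
      ∀ x, τ (A x) = B (τ x) := by
    intro A B hAB x
    have : A.comp U = U.comp B := Hardy.clm_ext hAB
    have := congrArg (fun T : Hardy E →L[ℂ] H => T (τ x)) this
    change A (τ.symm (τ x)) = τ.symm (B (τ x)) at this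
    rw [τ.symm_apply_apply] at this
    rw [this, τ.apply_symm_apply]
  refine ⟨τ, key _ _ fun i j a => ?_, key _ _ fun i j a => ?_⟩
  · rw [mul_apply_eq_comp, Hardy.diagonal_monomial, map_smul, map_smul, Hardy.M₁_monomial, hm, hm,
      translate_apply, translate_apply, ← Circle.smul_def, smul_smul, phase_succ_left,
      Circle.smul_def, Circle.smul_def, map_smul, pow_succ', mul_apply_eq_comp]
  · rw [mul_apply_eq_comp, Hardy.M₂_monomial, Hardy.diagonal_monomial, map_smul, hm, hm,
      translate_apply, translate_apply, ← Circle.smul_def, smul_smul, phase_succ_right,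
      Circle.smul_def, map_smul, ← Circle.smul_def, h.apply_pow, smul_smul, mul_comm (phase _ _),
      pow_succ', mul_apply_eq_comp]

/-- Limits are unique, so the rotations quantified over in the model can only be the diagonal ones.
-/
theorem hasTwistedHardyModel_iff :
    HasTwistedHardyModel (q : ℂ) V₁ V₂ E ↔
      PairUnitarilyEquivalent V₁ V₂ (Hardy.M₁ E * Hardy.diagonal fun n => q ^ min n.1 n.2)
        ((Hardy.diagonal fun n => q⁻¹ ^ min n.1 n.2) * Hardy.M₂ E) := by
  constructor
  · rintro ⟨s, s', -, rfl, hs, -, h⟩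
    rwa [Hardy.eq_diagonal_of_isRotationAlong hs, Hardy.star_rotation] at h
  · intro h
    refine ⟨_, _, Hardy.diagonal_mem_unitary _, (Hardy.star_rotation q).symm,
      Hardy.isRotationAlong_diagonal q, ?_, h⟩
    rw [← Circle.coe_inv_eq_conj]
    exact Hardy.isRotationAlong_diagonal q⁻¹

end Model

/-! ### Invariance under unitary equivalence -/

theorem adjoint_intertwines {V : H →L[ℂ] H} {W : K →L[ℂ] K} {τ : H ≃ₗᵢ[ℂ] K}
    (h : ∀ x, τ (V x) = W (τ x)) (x : H) : τ (adjoint V x) = adjoint W (τ x) := by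
  refine ext_inner_left ℂ fun y => ?_
  obtain ⟨y, rfl⟩ := τ.surjective y
  rw [τ.inner_map_map, adjoint_inner_right, adjoint_inner_right, ← h, τ.inner_map_map]

namespace PairUnitarilyEquivalent

variable {q : ℂ} {V₁ V₂ : H →L[ℂ] H} {W₁ W₂ : K →L[ℂ] K}

theorem isDoublyQCommutative (h : PairUnitarilyEquivalent V₁ V₂ W₁ W₂)
    (hW : IsDoublyQCommutative q W₁ W₂) : IsDoublyQCommutative q V₁ V₂ := by
  obtain ⟨τ, h1, h2⟩ := h
  refine ⟨ContinuousLinearMap.ext fun x => τ.injective ?_,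
    ContinuousLinearMap.ext fun x => τ.injective ?_⟩
  · have := congrArg (fun A : K →L[ℂ] K => A (τ x)) hW.1
    simpa [h1, h2] using this
  · have := congrArg (fun A : K →L[ℂ] K => A (τ x)) hW.2
    simpa [h1, h2, adjoint_intertwines h1] using this

theorem finrank_wandering_eq (h : PairUnitarilyEquivalent V₁ V₂ W₁ W₂) :
    Module.finrank ℂ (wandering V₁ V₂) = Module.finrank ℂ (wandering W₁ W₂) := by
  obtain ⟨τ, h1, h2⟩ := h
  have : wandering V₁ V₂ = (wandering W₁ W₂).comap τ.toLinearEquiv.toLinearMap := by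
    ext x
    rw [Submodule.mem_comap, mem_wandering, mem_wandering]
    change _ ↔ adjoint W₁ (τ x) = 0 ∧ adjoint W₂ (τ x) = 0
    rw [← adjoint_intertwines h1, ← adjoint_intertwines h2, map_eq_zero_iff _ τ.injective,
      map_eq_zero_iff _ τ.injective]
  rw [this]
  exact (τ.toLinearEquiv.ofSubmodule' _).finrank_eq

end PairUnitarilyEquivalent

end Operators

end QShift

theorem corollaryC {H : Type u} [NormedAddCommGroup H] [InnerProductSpace ℂ H] [CompleteSpace H]
    (q : ℂ) (hq : ‖q‖ = 1) (V₁ V₂ : H →L[ℂ] H)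
    (h₁ : QShift.IsShift V₁) (h₂ : QShift.IsShift V₂) :
    (QShift.IsDoublyQCommutative q V₁ V₂ ↔
      ∃ (E : Type u) (_ : NormedAddCommGroup E) (_ : InnerProductSpace ℂ E)
        (_ : CompleteSpace E), QShift.HasTwistedHardyModel q V₁ V₂ E) ∧
    (QShift.IsDoublyQCommutative q V₁ V₂ ∧
        Module.finrank ℂ
          ↥(LinearMap.ker (ContinuousLinearMap.adjoint V₁).toLinearMap ⊓
            LinearMap.ker (ContinuousLinearMap.adjoint V₂).toLinearMap) = 1 ↔
      QShift.HasTwistedHardyModel q V₁ V₂ ℂ) := by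
  obtain ⟨q, rfl⟩ : ∃ p : Circle, (p : ℂ) = q := ⟨⟨q, mem_sphere_zero_iff_norm.2 hq⟩, rfl⟩
  refine ⟨⟨fun h => ⟨QShift.wandering V₁ V₂, inferInstance, inferInstance, inferInstance, ?_⟩, ?_⟩,
    ?_, fun h => ?_⟩
  · exact QShift.hasTwistedHardyModel_iff.2
      (h.pairUnitarilyEquivalent h₁ h₂ (LinearIsometryEquiv.refl ℂ _))
  · rintro ⟨E, _, _, _, h⟩
    exact (QShift.hasTwistedHardyModel_iff.1 h).isDoublyQCommutative
      (QShift.Hardy.isDoublyQCommutative_model q)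
  · rintro ⟨h, hdim⟩
    -- `finrank` is `0` in infinite dimension, so the value `1` forces finite dimension and hence a
    -- finite orthonormal basis.
    have : FiniteDimensional ℂ (QShift.wandering V₁ V₂) :=
      Module.finite_of_finrank_pos (by rw [hdim]; exact one_pos)
    have φ : ℂ ≃ₗᵢ[ℂ] QShift.wandering V₁ V₂ :=
      (stdOrthonormalBasis ℂ ℂ).equiv (stdOrthonormalBasis ℂ _)
        (finCongr (by rw [hdim, Module.finrank_self]))
    exact QShift.hasTwistedHardyModel_iff.2 (h.pairUnitarilyEquivalent h₁ h₂ φ)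
  · have h' := QShift.hasTwistedHardyModel_iff.1 h
    exact ⟨h'.isDoublyQCommutative (QShift.Hardy.isDoublyQCommutative_model q),
      h'.finrank_wandering_eq.trans (QShift.Hardy.finrank_wandering_model q)⟩
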